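/- There is a polynomial-time algorithm $A$ for Minimum Vertex Cover that maps every finite undirected multigraph $G$ (multi-edges and self-loops allowed) to a vertex cover $A(G)$ of $G$ and has the following property. Let $\beta > 2$ and $\alpha \ge 0$ be real, and let $\Delta = \lfloor e^{\alpha/\beta} \rfloor$. For $1 \le i \le \Delta$ let $y_i = \lfloor e^{\alpha}/i^{\beta} \rfloor$, except that $y_1 = \lfloor e^{\alpha} \rfloor + 1$ if $\sum_{j=1}^{\Delta} j \lfloor e^{\alpha}/j^{\beta} \rfloor$ is odd. Let $G$ be the random multigraph of the Aiello–Chung–Lu $(\alpha,\beta)$-model: the vertex set is $\{1,\dots,n\}$ with $n = \sum_{i=1}^{\Delta} y_i$, exactly $y_i$ vertices have prescribed degree $i$ for each $1 \le i \le \Delta$ (with an arbitrary fixed labelling), each vertex $v$ is replaced by $\deg(v)$ distinct copies, a perfect matching on the set of all copies is chosen uniformly at random, and the number of edges of $G$ joining $u$ and $v$ is the number of matched pairs consisting of a copy of $u$ and a copy of $v$. Then the expected approximation ratio satisfies $$\mathbb{E}\left[\frac{|A(G)|}{\mathrm{OPT}(G)}\right] \le 2 - \frac{\zeta(\beta) -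 1 - 2^{-\beta}}{2^{\beta}\,\zeta(\beta-1)\,\zeta(\beta)},$$ where $\mathrm{OPT}(G)$ is the minimum cardinality of a vertex cover of $G$ and $\zeta$ is the Riemann zeta function. The algorithm receives only the graph $G$ (not $\alpha$ or $\beta$), and the same algorithm works for all $\alpha$ and $\beta$. -/

import Mathlib

open scoped BigOperators

namespace PowerLaw

/-- A finite undirected graph on the vertex set `Fin numVerts`, with multi-edges and self-loops:
`mult s(u, v)` is the number of edges joining `u` and `v`, and `mult s(v, v)` is the number of
loops at `v`. -/
structure Multigraph where
  numVerts : ℕ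
  mult : Sym2 (Fin numVerts) → ℕ

namespace Multigraph

/-- Every edge has at least one endpoint in `C` (so a vertex with a loop belongs to `C`). -/
def IsVertexCover (G : Multigraph) (C : Finset (Fin G.numVerts)) : Prop :=
  ∀ e : Sym2 (Fin G.numVerts), 0 < G.mult e → ∃ v ∈ C, v ∈ e

/-- The minimum cardinality of a vertex cover (the set below contains `numVerts`). -/
noncomputable def vertexCoverNumber (G : Multigraph) : ℕ :=
  sInf {k : ℕ | ∃ C : Finset (Fin G.numVerts), G.IsVertexCover C ∧ C.card = k}

/-- The input alphabet: a tally mark, the end of a matrix entry, the end of a matrix row. -/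
inductive Letter
  | tally
  | endEntry
  | endRow
  deriving DecidableEq

/-- The adjacency matrix of `G`, row by row, with entries in unary. Its length is
`n ^ 2 + n` plus the sum of the entries, hence polynomially related to the number of vertices
plus the number of edges. -/
def encode (G : Multigraph) : List Letter :=
  (List.finRange G.numVerts).flatMap fun u =>
    ((List.finRange G.numVerts).flatMap fun v =>
      List.replicate (G.mult s(u, v)) Letter.tally ++ [Letter.endEntry]) ++ [Letter.endRow]

end Multigraph

/-- A set of vertices, written as its 0-1 characteristic vector. -/
def encodeVertexSet (C : (n : ℕ) × Finset (Fin n)) : List Bool :=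
  List.ofFn fun v : Fin C.1 => decide (v ∈ C.2)

/-- `A` maps each multigraph to one of its vertex covers, and a Turing machine computes
this map in a number of steps polynomial in the length of the input. -/
def IsPolyTimeVertexCoverAlgorithm (A : (G : Multigraph) → Finset (Fin G.numVerts)) : Prop :=
  (∀ G : Multigraph, G.IsVertexCover (A G)) ∧
    Nonempty (Turing.TM2ComputableInPolyTime Multigraph.encode encodeVertexSet
      (fun G => (⟨G.numVerts, A G⟩ : (n : ℕ) × Finset (Fin n))))

/-- The maximum degree `⌊e ^ (α / β)⌋`. -/
noncomputable def maxDegree (α β : ℝ) : ℕ := ⌊Real.exp (α / β)⌋₊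

/-- The number of vertices of degree `i`. It is `⌊e ^ α / i ^ β⌋` for `1 ≤ i ≤ maxDegree α β`, with
one more vertex of degree `1` when the sum of the degrees would otherwise be odd. -/
noncomputable def degreeCount (α β : ℝ) (i : ℕ) : ℕ :=
  if i ∈ Finset.Icc 1 (maxDegree α β) then
    if 1 < i ∨ Even (∑ j ∈ Finset.Icc 1 (maxDegree α β), j * ⌊Real.exp α / (j : ℝ) ^ β⌋₊) then
      ⌊Real.exp α / (i : ℝ) ^ β⌋₊
    else ⌊Real.exp α⌋₊ + 1
  else 0

/-- `d` is the degree sequence of the `(α, β)`-model, for some labelling of the vertices. -/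
def IsPowerLawDegreeSequence (α β : ℝ) {n : ℕ} (d : Fin n → ℕ) : Prop :=
  ∀ i : ℕ, (Finset.univ.filter fun v => d v = i).card = degreeCount α β i

/-- The set consisting of `d v` distinct copies of each vertex `v`. -/
abbrev Copies {n : ℕ} (d : Fin n → ℕ) : Type := (v : Fin n) × Fin (d v)

/-- A perfect matching on `L`, given by the map that sends each point to its partner. -/
abbrev PerfectMatching (L : Type) : Type :=
  {f : L → L // Function.Involutive f ∧ ∀ p, f p ≠ p}

noncomputable instance (L : Type) [Finite L] : Fintype (PerfectMatching L) :=
  Fintype.ofFinite _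

open Classical in
/-- The multigraph of a perfect matching on the copies of the vertices: the number of edges joining
`u` and `v` is the number of pairs of the matching that consist of a copy of `u` and a
copy of `v`. -/
noncomputable def matchingGraph {n : ℕ} (d : Fin n → ℕ) (f : PerfectMatching (Copies d)) :
    Multigraph where
  numVerts := n
  mult e := ((Finset.univ.image fun p : Copies d => s(p, f.1 p)).filter
    fun ε => ε.map Sigma.fst = e).card

/-- The expectation of `X` over the random multigraph obtained from a uniformly random
perfect matching on the copies of the vertices. -/
noncomputable def expectation {n : ℕ} (d : Fin n → ℕ) (X : Multigraph → ℝ) : ℝ :=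
  Finset.expect Finset.univ fun f : PerfectMatching (Copies d) => X (matchingGraph d f)

end PowerLaw

/-! The edges `uv` through which `visit` adds vertices in the two rounds are pairwise disjoint. If
there are `a` of them in round one and `b` in round two, every vertex cover has at least `a + b`
vertices, while round one chooses `a` vertices and round two at most `2b`. Hence |greedy| + |leaf
cover| ≤ 2 OPT (`card_greedyCover_add_card_leafCover_le`), so the ratio is at most 2 - |leaf cover|
/ OPT.

A leaf and its neighbour cannot both escape the leaf cover. Looking only at the first copy of each
vertex therefore gives |leaf neighbours| ≤ 2 |leaf cover|, and this count has an exact expectation: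
the partner of a fixed copy is uniform among the other copies, so with `y` leaves and `L` copies the
mean is `(n - 1) y / (L - 1)`. A leaf can be left out of a cover, so OPT ≤ n - 1; the factors `n -
1` cancel and the expected ratio is at most `2 - y / (2 (L - 1))`.

In the model, `y ≥ ⌊e^α⌋ ≥ e^α / 2` and `L - 1 ≤ e^α ζ(β - 1)`, which gives `2 - 1 / (4 ζ(β - 1))`.
This implies the claim since `2^β ≥ 4` and `ζ(β) - 1 - 2^(-β) ≤ ζ(β)`.

Polynomial time is shown by an explicit multi-stack machine that reads the matrix once per round;
reading one row performs one `visit`. -/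

namespace PowerLaw
-- The two-round greedy cover and its matching bound
namespace Multigraph

/-- The number of edges at `u`, where a loop counts once. -/
def incidence (G : Multigraph) (u : Fin G.numVerts) : ℕ :=
  ∑ v, G.mult s(u, v)

/-- The first neighbour of `u` outside `C`. -/
def firstUncovered (G : Multigraph) (C : Finset (Fin G.numVerts)) (u : Fin G.numVerts) :
    Option (Fin G.numVerts) :=
  (List.finRange G.numVerts).find? fun v => decide (0 < G.mult s(u, v)) && !decide (v ∈ C)

/-- The treatment of the vertex `u` when `C` is the set chosen so far. In the first round
(`mode = false`) only a vertex with a single incident edge is treated, and the other end of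
this edge is chosen. In the second round both ends of an uncovered edge are chosen. -/
def visit (G : Multigraph) (mode : Bool) (C : Finset (Fin G.numVerts)) (u : Fin G.numVerts) :
    Finset (Fin G.numVerts) :=
  if u ∉ C ∧ (mode = true ∨ G.incidence u = 1) then
    match G.firstUncovered C u with
    | none => C
    | some v => if mode then insert u (insert v C) else insert v C
  else C

/-- The vertices chosen in the first round. -/
def leafCover (G : Multigraph) : Finset (Fin G.numVerts) :=
  (List.finRange G.numVerts).foldl (G.visit false) ∅

/-- The vertex cover chosen after both rounds. -/
def greedyCover (G : Multigraph) : Finset (Fin G.numVerts) :=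
  (List.finRange G.numVerts).foldl (G.visit true) G.leafCover

variable {G : Multigraph}

theorem firstUncovered_eq_none {C : Finset (Fin G.numVerts)} {u : Fin G.numVerts}
    (h : G.firstUncovered C u = none) (v : Fin G.numVerts) (hv : 0 < G.mult s(u, v)) : v ∈ C := by
  have := List.find?_eq_none.1 h v (List.mem_finRange v)
  simpa [hv] using this

theorem firstUncovered_eq_some {C : Finset (Fin G.numVerts)} {u v : Fin G.numVerts}
    (h : G.firstUncovered C u = some v) : 0 < G.mult s(u, v) ∧ v ∉ C := by
  simpa using List.find?_some h

theorem visit_eq_self_or (mode : Bool) (C : Finset (Fin G.numVerts)) (u : Fin G.numVerts) :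
    G.visit mode C u = C ∨ ∃ v, u ∉ C ∧ (mode = true ∨ G.incidence u = 1) ∧ v ∉ C ∧
      0 < G.mult s(u, v) ∧
      G.visit mode C u = if mode then insert u (insert v C) else insert v C := by
  by_cases h : u ∉ C ∧ (mode = true ∨ G.incidence u = 1)
  · rw [visit, if_pos h]
    split
    · exact Or.inl rfl
    · next v hv =>
      obtain ⟨hv0, hvC⟩ := firstUncovered_eq_some hv
      exact Or.inr ⟨v, h.1, h.2, hvC, hv0, rfl⟩
  · rw [visit, if_neg h]
    exact Or.inl rfl

theorem subset_visit (mode : Bool) (C : Finset (Fin G.numVerts)) (u : Fin G.numVerts) :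
    C ⊆ G.visit mode C u := by
  rcases visit_eq_self_or mode C u with h | ⟨v, -, -, -, -, h⟩
  · rw [h]
  · intro x hx
    rw [h]
    split_ifs <;> simp [hx]

/-- The chosen set only grows, so whatever the visit of `u` achieves survives all later visits. -/
theorem foldl_visit_of_upward_closed (mode : Bool)
    (Q : Fin G.numVerts → Finset (Fin G.numVerts) → Prop)
    (hmono : ∀ u C C', C ⊆ C' → Q u C → Q u C') (hvisit : ∀ u C, Q u (G.visit mode C u))
    (l : List (Fin G.numVerts)) (C : Finset (Fin G.numVerts)) :
    C ⊆ l.foldl (G.visit mode) C ∧ ∀ u ∈ l, Q u (l.foldl (G.visit mode) C) := by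
  induction l generalizing C with
  | nil => simp
  | cons a l ih =>
    obtain ⟨h1, h2⟩ := ih (G.visit mode C a)
    refine ⟨(subset_visit mode C a).trans h1, fun u hu => ?_⟩
    rcases List.mem_cons.1 hu with rfl | hu
    · exact hmono _ _ _ h1 (hvisit _ _)
    · exact h2 u hu

theorem foldl_visit_of_invariant (mode : Bool) (P : Finset (Fin G.numVerts) → Prop)
    (hvisit : ∀ C u, P C → P (G.visit mode C u)) (l : List (Fin G.numVerts))
    (C : Finset (Fin G.numVerts)) (hC : P C) : P (l.foldl (G.visit mode) C) := by
  induction l generalizing C with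
  | nil => exact hC
  | cons a l ih => exact ih _ (hvisit _ _ hC)

theorem visit_covers (mode : Bool) (u : Fin G.numVerts) (C : Finset (Fin G.numVerts)) :
    (mode = true ∨ G.incidence u = 1) →
      u ∈ G.visit mode C u ∨ ∀ w, 0 < G.mult s(u, w) → w ∈ G.visit mode C u := by
  intro h
  by_cases hu : u ∈ C
  · exact Or.inl (subset_visit mode C u hu)
  unfold visit
  rw [if_pos ⟨hu, h⟩]
  split
  · next h0 => exact Or.inr (firstUncovered_eq_none h0)
  · next v hv =>
    cases mode with
    | true => left; simp
    | false =>
      right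
      intro w hw
      obtain ⟨hv0, -⟩ := firstUncovered_eq_some hv
      have h1 : ∑ v, G.mult s(u, v) = 1 := by simpa [incidence] using h
      suffices w = v by simp [this]
      by_contra hne
      -- A second neighbour would raise the incidence to at least two.
      have : ∑ x ∈ ({w, v} : Finset _), G.mult s(u, x) ≤ ∑ x, G.mult s(u, x) :=
        Finset.sum_le_sum_of_subset (Finset.subset_univ _)
      rw [Finset.sum_pair hne, h1] at this
      omega

theorem foldl_visit_covers (mode : Bool) (C : Finset (Fin G.numVerts)) (u : Fin G.numVerts)
    (h : mode = true ∨ G.incidence u = 1) :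
    u ∈ (List.finRange G.numVerts).foldl (G.visit mode) C ∨ ∀ w, 0 < G.mult s(u, w) →
      w ∈ (List.finRange G.numVerts).foldl (G.visit mode) C := by
  refine (foldl_visit_of_upward_closed mode
    (fun u C => (mode = true ∨ G.incidence u = 1) → u ∈ C ∨ ∀ w, 0 < G.mult s(u, w) → w ∈ C)
    ?_ (visit_covers mode) (List.finRange G.numVerts) C).2 u (List.mem_finRange u) h
  intro u C C' hCC' hQ hu
  exact (hQ hu).imp (fun h => hCC' h) (fun h w hw => hCC' (h w hw))

theorem leafCover_covers {u w : Fin G.numVerts} (hu : G.incidence u = 1)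
    (hw : 0 < G.mult s(u, w)) : u ∈ G.leafCover ∨ w ∈ G.leafCover :=
  (foldl_visit_covers false ∅ u (Or.inr hu)).imp_right fun h => h w hw

theorem isVertexCover_greedyCover (G : Multigraph) : G.IsVertexCover G.greedyCover := by
  intro e
  induction e using Sym2.ind with
  | _ u w =>
    intro hw
    rcases foldl_visit_covers true G.leafCover u (Or.inl rfl) with h | h
    · exact ⟨u, h, Sym2.mem_mk_left u w⟩
    · exact ⟨w, h w hw, Sym2.mem_mk_right u w⟩

/-- `U` consists of `C` and of vertices whose neighbours all belong to `C`. -/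
def IsSaturation (G : Multigraph) (C U : Finset (Fin G.numVerts)) : Prop :=
  C ⊆ U ∧ ∀ u ∈ U, u ∉ C → ∀ w, 0 < G.mult s(u, w) → w ∈ C

/-- This is the disjointness of the selected edges: `U` holds the ends of the edges selected so far,
and a vertex of `U` outside `C` has no uncovered edge left. -/
theorem IsSaturation.notMem {C U : Finset (Fin G.numVerts)} (h : G.IsSaturation C U)
    {u v : Fin G.numVerts} (hu : u ∉ C) (hv : v ∉ C) (huv : 0 < G.mult s(u, v)) :
    u ∉ U ∧ v ∉ U :=
  ⟨fun hU => hv (h.2 u hU hu v huv), fun hU => hu (h.2 v hU hv u (by rwa [Sym2.eq_swap]))⟩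

/-- Each new disjoint edge costs an arbitrary cover `K` one more vertex. Loops, with `u = v`, are
allowed. -/
theorem IsVertexCover.card_inter_lt {K U : Finset (Fin G.numVerts)} (hK : G.IsVertexCover K)
    {u v : Fin G.numVerts} (hu : u ∉ U) (hv : v ∉ U) (huv : 0 < G.mult s(u, v)) :
    (K ∩ U).card < (K ∩ insert u (insert v U)).card := by
  refine Finset.card_lt_card ⟨?_, fun hsub => ?_⟩
  · exact Finset.inter_subset_inter_left fun x hx => by simp [hx]
  obtain ⟨x, hxK, hx⟩ := hK _ huv
  have hx' : x = u ∨ x = v := by simpa using hx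
  have : x ∈ K ∩ U := hsub (by rcases hx' with rfl | rfl <;> simp [hxK])
  rcases hx' with rfl | rfl
  · exact hu (Finset.mem_inter.1 this).2
  · exact hv (Finset.mem_inter.1 this).2

theorem exists_saturation_leafCover {K : Finset (Fin G.numVerts)} (hK : G.IsVertexCover K) :
    ∃ U, G.IsSaturation G.leafCover U ∧ G.leafCover.card ≤ (K ∩ U).card := by
  refine foldl_visit_of_invariant false
    (fun C => ∃ U, G.IsSaturation C U ∧ C.card ≤ (K ∩ U).card) ?_ _ ∅
    ⟨∅, ⟨by simp, by simp⟩, by simp⟩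
  rintro C u ⟨U, hU, hcard⟩
  rcases visit_eq_self_or false C u with h | ⟨v, huC, hu, hvC, hv0, h⟩
  · exact ⟨U, by rwa [h], by rwa [h]⟩
  have hcov := visit_covers false u C hu
  simp only [Bool.false_eq_true, if_false] at h
  rw [h] at hcov ⊢
  obtain ⟨huU, hvU⟩ := hU.notMem huC hvC hv0
  have hlt := hK.card_inter_lt huU hvU hv0
  -- `U` absorbs both ends although only `v` is chosen; `u` may stay outside the cover because its
  -- single edge is now covered.
  refine ⟨insert u (insert v U), ⟨?_, ?_⟩, ?_⟩
  · exact (Finset.insert_subset_insert _ hU.1).trans (Finset.subset_insert _ _)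
  · intro x hx hxC w hw
    rcases Finset.mem_insert.1 hx with rfl | hx
    · exact hcov.resolve_left hxC w hw
    simp only [Finset.mem_insert, not_or] at hxC hx ⊢
    exact Or.inr (hU.2 x (hx.resolve_left hxC.1) hxC.2 w hw)
  · have := Finset.card_insert_le v C
    omega

theorem card_greedyCover_add_card_leafCover_le {K : Finset (Fin G.numVerts)}
    (hK : G.IsVertexCover K) : G.greedyCover.card + G.leafCover.card ≤ 2 * K.card := by
  obtain ⟨U₀, hU₀, hcard₀⟩ := exists_saturation_leafCover hK
  suffices ∃ U, G.IsSaturation G.greedyCover U ∧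
      G.greedyCover.card + G.leafCover.card ≤ 2 * (K ∩ U).card by
    obtain ⟨U, -, h⟩ := this
    exact h.trans (Nat.mul_le_mul_left 2 (Finset.card_le_card Finset.inter_subset_left))
  refine foldl_visit_of_invariant true
    (fun C => ∃ U, G.IsSaturation C U ∧ C.card + G.leafCover.card ≤ 2 * (K ∩ U).card) ?_ _ _
    -- At the start of round two both summands equal |leaf cover|, so the bound from round one
    -- doubles.
    ⟨U₀, hU₀, by omega⟩
  rintro C u ⟨U, hU, hcard⟩
  rcases visit_eq_self_or true C u with h | ⟨v, huC, hu, hvC, hv0, h⟩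
  · exact ⟨U, by rwa [h], by rwa [h]⟩
  rw [if_pos rfl] at h
  rw [h]
  obtain ⟨huU, hvU⟩ := hU.notMem huC hvC hv0
  have hlt := hK.card_inter_lt huU hvU hv0
  refine ⟨insert u (insert v U), ⟨?_, ?_⟩, ?_⟩
  · exact Finset.insert_subset_insert _ (Finset.insert_subset_insert _ hU.1)
  · intro x hx hxC w hw
    simp only [Finset.mem_insert, not_or] at hxC hx ⊢
    exact Or.inr (Or.inr (hU.2 x ((hx.resolve_left hxC.1).resolve_left hxC.2.1) hxC.2.2 w hw))
  · have h1 := Finset.card_insert_le v C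
    have h2 := Finset.card_insert_le u (insert v C)
    omega

theorem vertexCoverNumber_le {K : Finset (Fin G.numVerts)} (hK : G.IsVertexCover K) :
    G.vertexCoverNumber ≤ K.card :=
  Nat.sInf_le ⟨K, hK, rfl⟩

theorem card_greedyCover_add_card_leafCover_le_vertexCoverNumber (G : Multigraph) :
    G.greedyCover.card + G.leafCover.card ≤ 2 * G.vertexCoverNumber := by
  obtain ⟨K, hK, h⟩ := Nat.sInf_mem
    (⟨_, G.greedyCover, G.isVertexCover_greedyCover, rfl⟩ :
      {k : ℕ | ∃ C : Finset (Fin G.numVerts), G.IsVertexCover C ∧ C.card = k}.Nonempty)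
  rw [vertexCoverNumber, ← h]
  exact card_greedyCover_add_card_leafCover_le hK

end Multigraph

/-! ### Uniformity of the partner of a point -/

namespace PerfectMatching

/-- The image of a perfect matching under a permutation of the points. -/
def conj {L : Type} (σ : Equiv.Perm L) (f : PerfectMatching L) : PerfectMatching L :=
  ⟨fun p => σ (f.1 (σ.symm p)), fun p => by simp [f.2.1 (σ.symm p)], fun p h =>
    f.2.2 (σ.symm p) (by simpa using congrArg σ.symm h)⟩

/-- Conjugation by the transposition of `q` and `q'` fixes `p` and is an involution exchanging the
two families of matchings. -/
theorem card_apply_eq_comm {L : Type} [Finite L] [DecidableEq L] {p q q' : L} (hq : q ≠ p)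
    (hq' : q' ≠ p) :
    (Finset.univ.filter fun f : PerfectMatching L => f.1 p = q).card =
      (Finset.univ.filter fun f : PerfectMatching L => f.1 p = q').card := by
  have key : ∀ a, ∀ f ∈ Finset.univ.filter (fun f : PerfectMatching L => f.1 p = a),
        f.conj (Equiv.swap q q') ∈
          Finset.univ.filter (fun f : PerfectMatching L => f.1 p = Equiv.swap q q' a) := by
    intro a f hf
    simp only [Finset.mem_filter, Finset.mem_univ, true_and] at hf ⊢
    simp [conj, Equiv.swap_apply_of_ne_of_ne hq.symm hq'.symm, hf]
  have inv : ∀ f : PerfectMatching L,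
      (f.conj (Equiv.swap q q')).conj (Equiv.swap q q') = f := by
    intro f
    ext x
    simp [conj]
  refine Finset.card_bij' (fun f _ => f.conj (Equiv.swap q q'))
    (fun f _ => f.conj (Equiv.swap q q')) ?_ ?_ (fun f _ => inv f) (fun f _ => inv f)
  · simpa using key q
  · simpa using key q'

theorem card_apply_eq_mul {L : Type} [Fintype L] [DecidableEq L] {p q : L} (hq : q ≠ p) :
    (Fintype.card L - 1) * (Finset.univ.filter fun f : PerfectMatching L => f.1 p = q).card =
      Fintype.card (PerfectMatching L) := by
  have h := Finset.card_eq_sum_card_fiberwise (s := (Finset.univ : Finset (PerfectMatching L)))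
    (t := Finset.univ.erase p) (f := fun f => f.1 p) (fun f _ => by simp [f.2.2 p])
  rw [Finset.card_univ] at h
  rw [h, Finset.sum_congr rfl fun q' hq' => card_apply_eq_comm (Finset.ne_of_mem_erase hq') hq,
    Finset.sum_const, Finset.card_erase_of_mem (Finset.mem_univ p), Finset.card_univ, smul_eq_mul]

/-- The probability that `p` is matched into `S`, with denominators cleared; `p` itself must be
discarded because it is never its own partner. -/
theorem card_apply_mem_mul {L : Type} [Fintype L] [DecidableEq L] (p : L) (S : Finset L) :
    (Fintype.card L - 1) * (Finset.univ.filter fun f : PerfectMatching L => f.1 p ∈ S).card =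
      (S.erase p).card * Fintype.card (PerfectMatching L) := by
  have h := Finset.card_eq_sum_card_fiberwise
    (s := Finset.univ.filter fun f : PerfectMatching L => f.1 p ∈ S)
    (t := S.erase p) (f := fun f => f.1 p) (fun f hf => by simpa [f.2.2 p] using hf)
  rw [h, Finset.mul_sum, Finset.sum_congr rfl (g := fun _ => Fintype.card (PerfectMatching L)),
    Finset.sum_const, smul_eq_mul]
  intro q hq
  rw [← card_apply_eq_mul (Finset.ne_of_mem_erase hq), Finset.filter_filter]
  congr 3
  ext f
  have := Finset.mem_of_mem_erase hq
  constructor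
  · exact fun h => h.2
  · exact fun h => ⟨h ▸ this, h⟩

end PerfectMatching

/-! ### Leaves of the random multigraph and the expected ratio -/

variable {n : ℕ} {d : Fin n → ℕ}

theorem mult_matchingGraph_pos_iff {f : PerfectMatching (Copies d)} {e : Sym2 (Fin n)} :
    0 < (matchingGraph d f).mult e ↔ ∃ p, s(p.1, (f.1 p).1) = e := by
  classical
  simp only [matchingGraph, Finset.card_pos]
  constructor
  · rintro ⟨ε, hε⟩
    obtain ⟨h1, h2⟩ := Finset.mem_filter.1 hε
    obtain ⟨p, -, rfl⟩ := Finset.mem_image.1 h1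
    exact ⟨p, h2⟩
  · rintro ⟨p, hp⟩
    exact ⟨s(p, f.1 p), Finset.mem_filter.2
      ⟨Finset.mem_image.2 ⟨p, Finset.mem_univ p, rfl⟩, hp⟩⟩

theorem copy_eq_of_degree_eq_one {p q : Copies d} (hp : d p.1 = 1) (h : q.1 = p.1) : q = p := by
  obtain ⟨u, i⟩ := p
  obtain ⟨v, j⟩ := q
  obtain rfl : v = u := h
  have hi := i.2
  have hj := j.2
  dsimp only at hp hi hj
  congr 1
  ext
  omega

/-- Any matched pair lying over an edge at `p.1` must contain `p`, the only copy of that vertex, so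
there is exactly one such pair. -/
theorem incidence_matchingGraph {f : PerfectMatching (Copies d)} {p : Copies d}
    (hp : d p.1 = 1) : (matchingGraph d f).incidence p.1 = 1 := by
  classical
  have key : ∀ w : Fin n, (matchingGraph d f).mult s(p.1, w) = if w = (f.1 p).1 then 1 else 0 := by
    intro w
    have hq : ∀ q : Copies d, s(q.1, (f.1 q).1) = s(p.1, w) →
        s(q, f.1 q) = s(p, f.1 p) ∧ w = (f.1 p).1 := by
      intro q hq
      rcases Sym2.eq_iff.1 hq with ⟨h1, h2⟩ | ⟨h1, h2⟩
      · obtain rfl := copy_eq_of_degree_eq_one hp h1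
        exact ⟨rfl, h2.symm⟩
      · have h3 := copy_eq_of_degree_eq_one hp h2
        have h4 : q = f.1 p := by rw [← h3, f.2.1 q]
        rw [← h3, f.2.1 q]
        exact ⟨Sym2.eq_swap, h1.symm⟩
    split_ifs with h
    · refine Finset.card_eq_one.2 ⟨s(p, f.1 p), ?_⟩
      ext ε
      simp only [Finset.mem_filter, Finset.mem_image, Finset.mem_univ, true_and,
        Finset.mem_singleton]
      constructor
      · rintro ⟨⟨q, rfl⟩, h2⟩
        exact (hq q h2).1
      · rintro rfl
        exact ⟨⟨p, rfl⟩, by rw [h]; rfl⟩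
    · by_contra h0
      obtain ⟨q, h1⟩ := mult_matchingGraph_pos_iff.1 (Nat.pos_of_ne_zero h0)
      exact h (hq q h1).2
  change ∑ w : Fin n, (matchingGraph d f).mult s(p.1, w) = 1
  simp [key]

/-- The first copy of a vertex. -/
def firstCopy (hd : ∀ v, 0 < d v) (v : Fin n) : Copies d := ⟨v, ⟨0, hd v⟩⟩

/-- The vertices whose first copy is matched to a copy of a vertex of degree one. -/
def leafNeighbours (hd : ∀ v, 0 < d v) (f : PerfectMatching (Copies d)) : Finset (Fin n) :=
  Finset.univ.filter fun v => d (f.1 (firstCopy hd v)).1 = 1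

/-- Leaf neighbours inside the leaf cover number at most its size. For one outside, the leaf matched
to its first copy is in the leaf cover, and that leaf has a single copy, so it determines the
neighbour. -/
theorem card_leafNeighbours_le (hd : ∀ v, 0 < d v) (f : PerfectMatching (Copies d)) :
    (leafNeighbours hd f).card ≤ 2 * (matchingGraph d f).leafCover.card := by
  classical
  set C : Finset (Fin n) := (matchingGraph d f).leafCover with hC
  have h1 : (leafNeighbours hd f ∩ C).card ≤ C.card :=
    Finset.card_le_card Finset.inter_subset_right
  have h2 : (leafNeighbours hd f \ C).card ≤ C.card := by
    refine Finset.card_le_card_of_injOn (fun v => (f.1 (firstCopy hd v)).1) ?_ ?_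
    · intro v hv
      obtain ⟨hv1, hvC⟩ := Finset.mem_sdiff.1 hv
      have hv2 : d (f.1 (firstCopy hd v)).1 = 1 := (Finset.mem_filter.1 hv1).2
      refine (Multigraph.leafCover_covers (G := matchingGraph d f) (w := v)
        (incidence_matchingGraph hv2) ?_).resolve_right hvC
      exact mult_matchingGraph_pos_iff.2 ⟨firstCopy hd v, Sym2.eq_swap⟩
    · intro v hv w hw hvw
      have hw2 : d (f.1 (firstCopy hd w)).1 = 1 :=
        (Finset.mem_filter.1 (Finset.mem_sdiff.1 hw).1).2
      have := f.2.1.injective (copy_eq_of_degree_eq_one hw2 hvw)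
      exact congrArg Sigma.fst this
  have := Finset.card_inter_add_card_sdiff (leafNeighbours hd f) C
  change (leafNeighbours hd f).card ≤ 2 * Finset.card (α := Fin n) C
  omega

/-- A vertex with a single copy carries no loop, so all the other vertices form a cover. -/
theorem vertexCoverNumber_matchingGraph_le (f : PerfectMatching (Copies d)) {u : Fin n}
    (hu : d u = 1) : (matchingGraph d f).vertexCoverNumber ≤ n - 1 := by
  classical
  have hcover : (matchingGraph d f).IsVertexCover (Finset.univ.erase u) := by
    intro e he
    obtain ⟨p, rfl⟩ := mult_matchingGraph_pos_iff.1 he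
    by_cases h1 : p.1 = u
    · refine ⟨(f.1 p).1, Finset.mem_erase.2 ⟨fun h2 => f.2.2 p ?_, Finset.mem_univ _⟩,
        Sym2.mem_mk_right _ _⟩
      exact copy_eq_of_degree_eq_one (by rw [h1, hu]) (h2.trans h1.symm)
    · exact ⟨p.1, Finset.mem_erase.2 ⟨h1, Finset.mem_univ _⟩, Sym2.mem_mk_left _ _⟩
  have hcard : (Finset.univ.erase u).card = n - 1 := by
    rw [Finset.card_erase_of_mem (Finset.mem_univ u), Finset.card_univ, Fintype.card_fin]
  exact (Multigraph.vertexCoverNumber_le hcover).trans_eq hcard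

theorem card_copies_of_degree_one :
    (Finset.univ.filter fun q : Copies d => d q.1 = 1).card =
      (Finset.univ.filter fun v => d v = 1).card := by
  refine Finset.card_bij (fun q _ => q.1) (fun q hq => by simpa using hq) ?_ ?_
  · intro q hq q' hq' h
    exact copy_eq_of_degree_eq_one (by simpa using hq') h
  · intro v hv
    have hv1 : d v = 1 := by simpa using hv
    exact ⟨⟨v, ⟨0, by omega⟩⟩, by simpa using hv1, rfl⟩

/-- Linearity of expectation over the first copies. Each vertex contributes `y` possible leaf
partners, except that the `y` leaves cannot be matched to themselves: `n y - y` in all. -/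
theorem sum_card_leafNeighbours (hd : ∀ v, 0 < d v) :
    (Fintype.card (Copies d) - 1) * ∑ f : PerfectMatching (Copies d), (leafNeighbours hd f).card =
      (n - 1) * (Finset.univ.filter fun v => d v = 1).card *
        Fintype.card (PerfectMatching (Copies d)) := by
  classical
  set y := (Finset.univ.filter fun v => d v = 1).card with hy
  set S := Finset.univ.filter fun q : Copies d => d q.1 = 1 with hS
  have hSy : S.card = y := card_copies_of_degree_one
  have h1 : ∑ f : PerfectMatching (Copies d), (leafNeighbours hd f).card =
      ∑ v, (Finset.univ.filter fun f : PerfectMatching (Copies d) =>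
        f.1 (firstCopy hd v) ∈ S).card := by
    simp only [leafNeighbours, Finset.card_filter, hS, Finset.mem_filter, Finset.mem_univ,
      true_and]
    exact Finset.sum_comm
  have h2 : ∑ v, ((S.erase (firstCopy hd v)).card + if d v = 1 then 1 else 0) = n * y := by
    have : ∀ v, ((S.erase (firstCopy hd v)).card + if d v = 1 then 1 else 0) = y := by
      intro v
      split_ifs with hv
      · have hm : firstCopy hd v ∈ S := Finset.mem_filter.2 ⟨Finset.mem_univ _, hv⟩
        rw [Finset.card_erase_add_one hm, hSy]
      · have hm : firstCopy hd v ∉ S := fun h => hv (Finset.mem_filter.1 h).2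
        rw [Finset.erase_eq_of_notMem hm, hSy, add_zero]
    simp [this]
  rw [Finset.sum_add_distrib, ← Finset.card_filter, ← hy] at h2
  rw [h1, Finset.mul_sum,
    Finset.sum_congr rfl fun v _ => PerfectMatching.card_apply_mem_mul (firstCopy hd v) S,
    ← Finset.sum_mul, Nat.sub_mul, one_mul, ← h2, Nat.add_sub_cancel]

theorem two_le_of_perfectMatching (f : PerfectMatching (Copies d)) {u : Fin n} (hu : d u = 1) :
    2 ≤ n := by
  by_contra hn
  have : Subsingleton (Fin n) := Fin.subsingleton_iff_le_one.2 (by omega)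
  exact f.2.2 ⟨u, ⟨0, by omega⟩⟩
    (copy_eq_of_degree_eq_one (p := ⟨u, ⟨0, by omega⟩⟩) hu (Subsingleton.elim _ _))

theorem le_sum_degrees (hd : ∀ v, 0 < d v) : n ≤ ∑ v, d v := by
  have : ∑ v : Fin n, 1 ≤ ∑ v, d v := Finset.sum_le_sum fun v _ => hd v
  simpa using this

theorem expectation_greedyCover_le_of_pos [hne : Nonempty (PerfectMatching (Copies d))]
    (hd : ∀ v, 0 < d v) {u : Fin n} (hu : d u = 1) :
    expectation d (fun G => (G.greedyCover.card : ℝ) / (G.vertexCoverNumber : ℝ)) ≤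
      2 - ((Finset.univ.filter fun v => d v = 1).card : ℝ) / (2 * ((∑ v, d v : ℕ) - 1)) := by
  classical
  obtain ⟨f₀⟩ := hne
  have hn := two_le_of_perfectMatching f₀ hu
  have hL : Fintype.card (Copies d) = ∑ v, d v := by simp [Fintype.card_sigma]
  have hL2 : 2 ≤ ∑ v, d v := hn.trans (le_sum_degrees hd)
  set y := (Finset.univ.filter fun v => d v = 1).card
  have hn' : (0 : ℝ) < (n : ℝ) - 1 := by
    have : (2 : ℝ) ≤ n := by exact_mod_cast hn
    linarith
  have hL' : (0 : ℝ) < (∑ v, d v : ℕ) - 1 := by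
    have : (2 : ℝ) ≤ (∑ v, d v : ℕ) := by exact_mod_cast hL2
    linarith
  have hpoint : ∀ f : PerfectMatching (Copies d),
      ((matchingGraph d f).greedyCover.card : ℝ) / ((matchingGraph d f).vertexCoverNumber : ℝ) ≤
        2 - ((leafNeighbours hd f).card : ℝ) / (2 * (n - 1)) := by
    intro f
    have h1 : ((matchingGraph d f).greedyCover.card : ℝ) + (matchingGraph d f).leafCover.card ≤
        2 * (matchingGraph d f).vertexCoverNumber := by
      exact_mod_cast
        Multigraph.card_greedyCover_add_card_leafCover_le_vertexCoverNumber (matchingGraph d f)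
    have h2 : ((leafNeighbours hd f).card : ℝ) ≤ 2 * (matchingGraph d f).leafCover.card := by
      exact_mod_cast card_leafNeighbours_le hd f
    have h3 : ((matchingGraph d f).vertexCoverNumber : ℝ) ≤ n - 1 := by
      have : ((matchingGraph d f).vertexCoverNumber : ℝ) ≤ ((n - 1 : ℕ) : ℝ) := by
        exact_mod_cast vertexCoverNumber_matchingGraph_le f hu
      rwa [Nat.cast_sub (by omega), Nat.cast_one] at this
    have h4 : (0 : ℝ) ≤ (matchingGraph d f).greedyCover.card := Nat.cast_nonneg _
    have h5 : ((leafNeighbours hd f).card : ℝ) / (2 * (n - 1)) ≤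
        (matchingGraph d f).leafCover.card / (n - 1) := by
      rw [div_le_div_iff₀ (by positivity) hn']
      nlinarith
    -- With OPT = 0 the quotient is 0 by convention, and the leaf cover is empty, so the bound still
    -- holds.
    rcases Nat.eq_zero_or_pos (matchingGraph d f).vertexCoverNumber with h0 | h0
    · rw [h0, Nat.cast_zero, mul_zero] at h1
      have h6 : ((matchingGraph d f).leafCover.card : ℝ) = 0 :=
        le_antisymm (by linarith) (Nat.cast_nonneg _)
      rw [h6, zero_div] at h5
      rw [h0, Nat.cast_zero, div_zero]
      linarith
    · have h0' : (0 : ℝ) < (matchingGraph d f).vertexCoverNumber := by exact_mod_cast h0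
      have h6 : ((matchingGraph d f).leafCover.card : ℝ) / (n - 1) ≤
          (matchingGraph d f).leafCover.card / (matchingGraph d f).vertexCoverNumber :=
        div_le_div_of_nonneg_left (Nat.cast_nonneg _) h0' h3
      have h7 : ((matchingGraph d f).greedyCover.card : ℝ) /
          ((matchingGraph d f).vertexCoverNumber : ℝ) ≤
          2 - (matchingGraph d f).leafCover.card / (matchingGraph d f).vertexCoverNumber := by
        rw [le_sub_iff_add_le, ← add_div, div_le_iff₀ h0']
        exact h1
      linarith
  have hsum : (((∑ v, d v : ℕ) : ℝ) - 1) *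
      ∑ f : PerfectMatching (Copies d), ((leafNeighbours hd f).card : ℝ) =
      (n - 1) * y * Fintype.card (PerfectMatching (Copies d)) := by
    have h := sum_card_leafNeighbours hd
    rw [hL] at h
    have h' := congrArg (Nat.cast : ℕ → ℝ) h
    rw [Nat.cast_mul, Nat.cast_mul, Nat.cast_mul, Nat.cast_sub (by omega),
      Nat.cast_sub (by omega), Nat.cast_one] at h'
    push_cast at h' ⊢
    exact h'
  have hN : (0 : ℝ) < Fintype.card (PerfectMatching (Copies d)) := by
    exact_mod_cast Fintype.card_pos_iff.2 ⟨f₀⟩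
  rw [expectation, Fintype.expect_eq_sum_div_card, div_le_iff₀ hN]
  refine (Finset.sum_le_sum fun f _ => hpoint f).trans_eq ?_
  rw [Finset.sum_sub_distrib, ← Finset.sum_div, Finset.sum_const, Finset.card_univ, nsmul_eq_mul]
  field_simp
  linear_combination -hsum

/-! ### Estimates for the zeta function -/

theorem re_riemannZeta_eq_tsum {s : ℝ} (hs : 1 < s) :
    (riemannZeta (s : ℂ)).re = ∑' n : ℕ, 1 / (n : ℝ) ^ s := by
  have h : riemannZeta (s : ℂ) = ((∑' n : ℕ, 1 / (n : ℝ) ^ s : ℝ) : ℂ) := by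
    rw [zeta_eq_tsum_one_div_nat_cpow (by simpa using hs), Complex.ofReal_tsum]
    refine tsum_congr fun n => ?_
    rw [Complex.ofReal_div, Complex.ofReal_cpow (Nat.cast_nonneg n)]
    simp
  rw [h, Complex.ofReal_re]

theorem sum_le_re_riemannZeta {s : ℝ} (hs : 1 < s) (t : Finset ℕ) :
    ∑ n ∈ t, 1 / (n : ℝ) ^ s ≤ (riemannZeta (s : ℂ)).re := by
  rw [re_riemannZeta_eq_tsum hs]
  exact (Real.summable_one_div_nat_rpow.2 hs).sum_le_tsum t fun n _ => by positivity

theorem one_le_re_riemannZeta {s : ℝ} (hs : 1 < s) : 1 ≤ (riemannZeta (s : ℂ)).re := by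
  simpa using sum_le_re_riemannZeta hs {1}

/-- Reduces the stated bound to the stronger one that the argument gives. -/
theorem zeta_fraction_le {β : ℝ} (hβ : 2 < β) :
    ((riemannZeta (β : ℂ)).re - 1 - 1 / (2 : ℝ) ^ β) /
      ((2 : ℝ) ^ β * (riemannZeta ((β : ℂ) - 1)).re * (riemannZeta (β : ℂ)).re) ≤
    1 / (4 * (riemannZeta ((β : ℂ) - 1)).re) := by
  have h1 : 1 ≤ (riemannZeta ((β : ℂ) - 1)).re := by
    simpa using one_le_re_riemannZeta (s := β - 1) (by linarith)
  have h2 := one_le_re_riemannZeta (s := β) (by linarith)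
  have h3 : (4 : ℝ) ≤ 2 ^ β := by
    calc (4 : ℝ) = 2 ^ (2 : ℝ) := by norm_num
      _ ≤ 2 ^ β := Real.rpow_le_rpow_of_exponent_le (by norm_num) hβ.le
  have h4 : 0 < 1 / (2 : ℝ) ^ β := by positivity
  generalize (riemannZeta ((β : ℂ) - 1)).re = Z at *
  generalize (riemannZeta (β : ℂ)).re = z at *
  generalize (2 : ℝ) ^ β = b at *
  calc (z - 1 - 1 / b) / (b * Z * z) ≤ z / (b * Z * z) := by
        gcongr
        linarith
    _ = 1 / (b * Z) := by field_simp
    _ ≤ 1 / (4 * Z) := by gcongr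

/-! ### Degree sums in the power-law model -/

section DegreeSequence

variable {α β : ℝ} {n : ℕ} {d : Fin n → ℕ}

theorem IsPowerLawDegreeSequence.mem_Icc (hd : IsPowerLawDegreeSequence α β d) (v : Fin n) :
    d v ∈ Finset.Icc 1 (maxDegree α β) := by
  by_contra h
  have h1 := hd (d v)
  rw [degreeCount, if_neg h, Finset.card_eq_zero] at h1
  have : v ∈ Finset.univ.filter fun w => d w = d v := by simp
  rw [h1] at this
  simp at this

theorem IsPowerLawDegreeSequence.sum_eq (hd : IsPowerLawDegreeSequence α β d) :
    ∑ v, d v = ∑ i ∈ Finset.Icc 1 (maxDegree α β), i * degreeCount α β i := by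
  rw [← Finset.sum_fiberwise_of_maps_to (fun v _ => hd.mem_Icc v)]
  refine Finset.sum_congr rfl fun i _ => ?_
  rw [← hd i, Finset.sum_congr rfl fun v hv => (Finset.mem_filter.1 hv).2, Finset.sum_const,
    smul_eq_mul, mul_comm]

theorem one_le_maxDegree (hα : 0 ≤ α) (hβ : 2 < β) : 1 ≤ maxDegree α β :=
  Nat.one_le_floor_iff _ |>.2 (Real.one_le_exp (div_nonneg hα (by linarith)))

theorem le_degreeCount_one (hα : 0 ≤ α) (hβ : 2 < β) :
    ⌊Real.exp α⌋₊ ≤ degreeCount α β 1 := by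
  rw [degreeCount, if_pos (Finset.mem_Icc.2 ⟨le_rfl, one_le_maxDegree hα hβ⟩)]
  split_ifs
  · simp
  · exact Nat.le_succ _

theorem sum_degreeCount_le :
    ∑ i ∈ Finset.Icc 1 (maxDegree α β), i * degreeCount α β i ≤
      ∑ i ∈ Finset.Icc 1 (maxDegree α β), i * ⌊Real.exp α / (i : ℝ) ^ β⌋₊ + 1 := by
  have h : ∀ i ∈ Finset.Icc 1 (maxDegree α β), i * degreeCount α β i ≤
      i * ⌊Real.exp α / (i : ℝ) ^ β⌋₊ + if i = 1 then 1 else 0 := by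
    intro i hi
    rw [degreeCount, if_pos hi]
    have hi1 := (Finset.mem_Icc.1 hi).1
    split_ifs with h1 h2 h2
    · exact Nat.le_succ _
    · exact le_rfl
    · subst h2
      simp
    · exact absurd (Or.inl (by omega)) h1
  refine (Finset.sum_le_sum h).trans ?_
  rw [Finset.sum_add_distrib, Finset.sum_ite_eq' _ 1 (fun _ => 1)]
  split_ifs <;> simp

/-- The `-1`, coming from the `L - 1` possible partners of a copy, absorbs exactly the vertex that
the parity correction may add. -/
theorem IsPowerLawDegreeSequence.sum_sub_one_le (hβ : 2 < β)
    (hd : IsPowerLawDegreeSequence α β d) :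
    ((∑ v, d v : ℕ) : ℝ) - 1 ≤ Real.exp α * (riemannZeta ((β : ℂ) - 1)).re := by
  have h1 : ((∑ v, d v : ℕ) : ℝ) ≤
      ((∑ i ∈ Finset.Icc 1 (maxDegree α β), i * ⌊Real.exp α / (i : ℝ) ^ β⌋₊ + 1 : ℕ) : ℝ) := by
    exact_mod_cast hd.sum_eq.trans_le sum_degreeCount_le
  have h2 : ((∑ i ∈ Finset.Icc 1 (maxDegree α β), i * ⌊Real.exp α / (i : ℝ) ^ β⌋₊ : ℕ) : ℝ) ≤
      Real.exp α * ∑ i ∈ Finset.Icc 1 (maxDegree α β), 1 / (i : ℝ) ^ (β - 1) := by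
    rw [Nat.cast_sum, Finset.mul_sum]
    refine Finset.sum_le_sum fun i hi => ?_
    have hi0 : (0 : ℝ) < i := by exact_mod_cast (Finset.mem_Icc.1 hi).1
    have hfl : (⌊Real.exp α / (i : ℝ) ^ β⌋₊ : ℝ) ≤ Real.exp α / (i : ℝ) ^ β :=
      Nat.floor_le (by positivity)
    rw [Nat.cast_mul, Real.rpow_sub_one hi0.ne']
    calc (i : ℝ) * (⌊Real.exp α / (i : ℝ) ^ β⌋₊ : ℝ) ≤ i * (Real.exp α / (i : ℝ) ^ β) := by gcongr
      _ = Real.exp α * (1 / ((i : ℝ) ^ β / i)) := by field_simp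
  have h3 := sum_le_re_riemannZeta (s := β - 1) (by linarith) (Finset.Icc 1 (maxDegree α β))
  have h4 := mul_le_mul_of_nonneg_left h3 (Real.exp_pos α).le
  push_cast at h1 h2 h4 ⊢
  linarith

theorem expectation_greedyCover_le (hα : 0 ≤ α) (hβ : 2 < β)
    (hd : IsPowerLawDegreeSequence α β d) :
    expectation d (fun G => (G.greedyCover.card : ℝ) / (G.vertexCoverNumber : ℝ)) ≤
      2 - ((riemannZeta (β : ℂ)).re - 1 - 1 / (2 : ℝ) ^ β) /
        ((2 : ℝ) ^ β * (riemannZeta ((β : ℂ) - 1)).re * (riemannZeta (β : ℂ)).re) := by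
  have hfrac := zeta_fraction_le hβ
  have hZ : 1 ≤ (riemannZeta ((β : ℂ) - 1)).re := by
    simpa using one_le_re_riemannZeta (s := β - 1) (by linarith)
  have hexp : 1 ≤ Real.exp α := Real.one_le_exp hα
  have hfloor : 1 ≤ ⌊Real.exp α⌋₊ := Nat.one_le_floor_iff _ |>.2 hexp
  have hy : ⌊Real.exp α⌋₊ ≤ (Finset.univ.filter fun v => d v = 1).card :=
    (le_degreeCount_one hα hβ).trans_eq (hd 1).symm
  obtain ⟨u, hu⟩ := Finset.card_pos.1 (hfloor.trans hy)
  replace hu := (Finset.mem_filter.1 hu).2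
  have hpos : ∀ v, 0 < d v := fun v => (Finset.mem_Icc.1 (hd.mem_Icc v)).1
  rcases isEmpty_or_nonempty (PerfectMatching (Copies d)) with h | h
  swap
  · refine (expectation_greedyCover_le_of_pos hpos hu).trans (sub_le_sub_left (hfrac.trans ?_) 2)
    have hL := hd.sum_sub_one_le hβ
    have hLpos : (0 : ℝ) < ((∑ v, d v : ℕ) : ℝ) - 1 := by
      have : (2 : ℝ) ≤ ((∑ v, d v : ℕ) : ℝ) := by
        exact_mod_cast (two_le_of_perfectMatching h.some hu).trans (le_sum_degrees hpos)
      linarith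
    have hy' : (⌊Real.exp α⌋₊ : ℝ) ≤ (Finset.univ.filter fun v => d v = 1).card := by
      exact_mod_cast hy
    have hf' : (1 : ℝ) ≤ ⌊Real.exp α⌋₊ := by exact_mod_cast hfloor
    -- As `⌊e^α⌋ ≥ 1`, this gives `e^α < 2 ⌊e^α⌋`, the source of the second factor 2 in `1 / (4 ζ(β
    -- - 1))`.
    have hlt := Nat.lt_floor_add_one (Real.exp α)
    rw [div_le_div_iff₀ (by positivity) (by positivity)]
    nlinarith
  -- The parity correction rules this case out, but no parity argument is needed: an average over
  -- the empty set is 0, and the bound is nonnegative.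
  · rw [expectation, Finset.univ_eq_empty, Finset.expect_empty]
    have : 1 / (4 * (riemannZeta ((β : ℂ) - 1)).re) ≤ 1 := by
      rw [div_le_one (by positivity)]
      linarith
    linarith

end DegreeSequence

/-! ### The Turing machine -/

instance : Fintype Multigraph.Letter :=
  ⟨{.tally, .endEntry, .endRow}, by rintro (_ | _ | _) <;> simp⟩

namespace CoverMachine

open Multigraph (Letter)

/-- The information that the machine keeps about a vertex: whether it has been chosen, a bit that
is flipped when its row is read, and whether it is the first uncovered neighbour of the vertex
whose row is being read. -/
structure Cell where
  chosen : Bool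
  passed : Bool
  candidate : Bool
  deriving DecidableEq

/-- The cell of a vertex before the first row is read. -/
def Cell.initial : Cell := ⟨false, false, false⟩

/-- The stacks of the machine. -/
inductive Stack
  | input
  | saved
  | front
  | back
  | output
  deriving DecidableEq

instance : Fintype Stack :=
  ⟨{.input, .saved, .front, .back, .output}, by rintro (_ | _ | _ | _ | _) <;> simp⟩

/-- The labels of the machine: reading a row, going back to the beginning of the list of vertices,
restoring the input, and producing the output. -/
inductive Label
  | scan
  | retreat
  | rewind
  | discard
  | collect
  | emit
  deriving DecidableEq

instance : Fintype Label :=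
  ⟨{.scan, .retreat, .rewind, .discard, .collect, .emit},
    fun l => by cases l <;> simp⟩

/-- The stack alphabets, all of which are finite. -/
abbrev Alphabet : Stack → Type
  | .input => Letter
  | .saved => Letter
  | .front => Cell
  | .back => Cell
  | .output => Bool

/-- What the machine knows about the current row: the round, whether the current entry is
positive, whether the row has at least one and at least two tally marks, whether an uncovered
neighbour has been found, whether the diagonal has been reached, and whether the vertex of the
row has been chosen. -/
structure Flags where
  mode : Bool
  tally : Bool
  seen : Bool
  more : Bool
  found : Bool
  diag : Bool
  cur : Bool

/-- The flags at the beginning of a row. -/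
def Flags.fresh (mode : Bool) : Flags := ⟨mode, false, false, false, false, false, false⟩

/-- The internal states: the flags, and registers for the symbols popped last. -/
structure State where
  letter : Option Letter
  cell : Option Cell
  flags : Flags

noncomputable instance : Fintype Cell :=
  Fintype.ofInjective (fun c => (c.chosen, c.passed, c.candidate)) <| by
    rintro ⟨⟩ ⟨⟩ h
    simpa using h

noncomputable instance : Fintype Flags :=
  Fintype.ofInjective (fun s => (s.mode, s.tally, s.seen, s.more, s.found, s.diag, s.cur)) <| by
    rintro ⟨⟩ ⟨⟩ h
    simpa using h

noncomputable instance : Fintype State :=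
  Fintype.ofInjective (fun s => (s.letter, s.cell, s.flags)) <| by
    rintro ⟨⟩ ⟨⟩ h
    simpa using h

namespace Flags

/-- Reading `m` tally marks. -/
def addTallies (s : Flags) (m : ℕ) : Flags :=
  { s with
    tally := s.tally || decide (0 < m)
    seen := s.seen || decide (0 < m)
    more := s.more || (s.seen && decide (0 < m)) || decide (2 ≤ m) }

/-- The cell `c` is the first one that has not been passed. -/
def isCurrent (s : Flags) (c : Cell) : Bool := !s.diag && (c.passed == s.mode)

/-- The cell `c` belongs to the first uncovered neighbour. -/
def isCandidate (s : Flags) (c : Cell) : Bool := s.tally && !c.chosen && !s.found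

/-- The new content of the cell `c` at the end of an entry. -/
def scanCell (s : Flags) (c : Cell) : Cell :=
  ⟨c.chosen, if s.isCurrent c then !s.mode else c.passed, s.isCandidate c⟩

/-- The flags at the end of an entry. -/
def afterCell (s : Flags) (c : Cell) : Flags :=
  { s with
    tally := false
    found := s.found || s.isCandidate c
    cur := if s.isCurrent c then c.chosen else s.cur
    diag := s.diag || s.isCurrent c }

/-- The current vertex has to be treated. -/
def ok (s : Flags) : Bool := s.found && !s.cur && (s.mode || (s.seen && !s.more))

/-- The new content of the cell `c` after the end of a row. -/
def retreatCell (s : Flags) (c : Cell) : Cell :=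
  ⟨c.chosen || (s.ok && (c.candidate || (s.mode && s.diag && (c.passed != s.mode)))),
    c.passed, false⟩

/-- The flags after the cell `c` has been rewritten. -/
def afterRetreat (s : Flags) (c : Cell) : Flags :=
  { s with diag := s.diag && (c.passed == s.mode) }

/-- The flags at the end of a row, given the entries and the cells. -/
def scanFlags (s : Flags) : List (ℕ × Cell) → Flags
  | [] => s
  | r :: rs => scanFlags ((s.addTallies r.1).afterCell r.2) rs

/-- The cells at the end of a row, given the entries and the previous cells. -/
def scanCells (s : Flags) : List (ℕ × Cell) → List Cell
  | [] => []
  | r :: rs => (s.addTallies r.1).scanCell r.2 ::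
      scanCells ((s.addTallies r.1).afterCell r.2) rs

/-- The cells after the end of a row, in the order in which they are rewritten. -/
def retreatCells (s : Flags) : List Cell → List Cell
  | [] => []
  | c :: cs => s.retreatCell c :: retreatCells (s.afterRetreat c) cs

end Flags

open Turing.TM2.Stmt in
/-- The program of the machine. -/
def program : Label → Turing.TM2.Stmt Alphabet Label State
  | .scan =>
    pop .input (fun s a => { s with letter := a }) <|
    branch (fun s => decide (s.letter = none))
      (goto fun s => if s.flags.mode then .discard else .rewind) <|
    push .saved (fun s => s.letter.getD .tally) <|
    branch (fun s => decide (s.letter = some .tally))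
      (load (fun s => ⟨none, none, s.flags.addTallies 1⟩) <| goto fun _ => .scan) <|
    branch (fun s => decide (s.letter = some .endRow))
      (load (fun s => ⟨none, none, s.flags⟩) <| goto fun _ => .retreat) <|
    pop .front (fun s c => { s with cell := c }) <|
    -- In the very first row `front` is empty; the default value creates the cells on the fly, so
    -- the machine never has to count the vertices beforehand.
    push .back (fun s => s.flags.scanCell (s.cell.getD .initial)) <|
    load (fun s => ⟨none, none, s.flags.afterCell (s.cell.getD .initial)⟩) <|
    goto fun _ => .scan
  | .retreat =>
    pop .back (fun s c => { s with cell := c }) <|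
    branch (fun s => decide (s.cell = none))
      (load (fun s => ⟨none, none, .fresh s.flags.mode⟩) <| goto fun _ => .scan) <|
    push .front (fun s => s.flags.retreatCell (s.cell.getD .initial)) <|
    load (fun s => ⟨none, none, s.flags.afterRetreat (s.cell.getD .initial)⟩) <|
    goto fun _ => .retreat
  | .rewind =>
    pop .saved (fun s a => { s with letter := a }) <|
    branch (fun s => decide (s.letter = none))
      (load (fun _ => ⟨none, none, .fresh true⟩) <| goto fun _ => .scan) <|
    push .input (fun s => s.letter.getD .tally) <|
    load (fun s => ⟨none, none, s.flags⟩) <|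
    goto fun _ => .rewind
  -- The halting configuration must have every stack except the output empty.
  | .discard =>
    pop .saved (fun s a => { s with letter := a }) <|
    branch (fun s => decide (s.letter = none))
      (goto fun _ => .collect) <|
    load (fun s => ⟨none, none, s.flags⟩) <|
    goto fun _ => .discard
  | .collect =>
    pop .front (fun s c => { s with cell := c }) <|
    branch (fun s => decide (s.cell = none))
      (goto fun _ => .emit) <|
    push .back (fun s => s.cell.getD .initial) <|
    load (fun s => ⟨none, none, s.flags⟩) <|
    goto fun _ => .collect
  | .emit =>
    pop .back (fun s c => { s with cell := c }) <|
    branch (fun s => decide (s.cell = none))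
      -- `Turing.haltList` requires the initial internal state at the end, so the flags are reset.
      (load (fun _ => ⟨none, none, .fresh false⟩) halt) <|
    push .output (fun s => (s.cell.getD .initial).chosen) <|
    load (fun s => ⟨none, none, s.flags⟩) <|
    goto fun _ => .emit

/-- The Turing machine that computes the vertex cover. -/
noncomputable def machine : Turing.FinTM2 where
  K := Stack
  k₀ := .input
  k₁ := .output
  Γ := Alphabet
  Λ := Label
  main := .scan
  σ := State
  initialState := ⟨none, none, .fresh false⟩
  Γk₀Fin := inferInstanceAs (Fintype Letter)
  m := program

/-- The configurations of the machine. -/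
abbrev Config : Type := Turing.TM2.Cfg Alphabet Label State

/-- The contents of the contents. -/
def contents (I T : List Letter) (F B : List Cell) (O : List Bool) : ∀ k, List (Alphabet k)
  | .input => I
  | .saved => T
  | .front => F
  | .back => B
  | .output => O

/-- The configuration with empty registers and the given label, flags and stacks. -/
def config (l : Option Label) (s : Flags) (I T : List Letter) (F B : List Cell) (O : List Bool) :
    Config :=
  ⟨l, ⟨none, none, s⟩, contents I T F B O⟩

/-- The machine goes from `a` to `b` in exactly `k` steps. -/
def ReachesIn (k : ℕ) (a b : Config) : Prop :=
  (flip bind (Turing.TM2.step program))^[k] (some a) = some b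

theorem ReachesIn.refl (a : Config) : ReachesIn 0 a a := rfl

theorem ReachesIn.trans {k₁ k₂ : ℕ} {a b c : Config} (h₁ : ReachesIn k₁ a b)
    (h₂ : ReachesIn k₂ b c) : ReachesIn (k₁ + k₂) a c := by
  unfold ReachesIn at *
  rw [Nat.add_comm, Function.iterate_add_apply, h₁, h₂]

theorem ReachesIn.head {k : ℕ} {a b c : Config} (h₁ : Turing.TM2.step program a = some b)
    (h₂ : ReachesIn k b c) : ReachesIn (k + 1) a c := by
  unfold ReachesIn at *
  rw [Function.iterate_succ_apply, ← h₂]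
  congr 1

/-! ### Single steps of the machine -/

section Stacks

variable (I T : List Letter) (F B : List Cell) (O : List Bool)

theorem update_input (x) :
    Function.update (contents I T F B O) .input x = contents x T F B O := by
  funext k; cases k <;> rfl

theorem update_saved (x) :
    Function.update (contents I T F B O) .saved x = contents I x F B O := by
  funext k; cases k <;> rfl

theorem update_front (x) :
    Function.update (contents I T F B O) .front x = contents I T x B O := by
  funext k; cases k <;> rfl

theorem update_back (x) :
    Function.update (contents I T F B O) .back x = contents I T F x O := by
  funext k; cases k <;> rfl

theorem update_output (x) :
    Function.update (contents I T F B O) .output x = contents I T F B x := by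
  funext k; cases k <;> rfl

end Stacks

section Steps

variable (s : Flags) (I T : List Letter) (F B : List Cell) (O : List Bool)

theorem step_scan_nil :
    Turing.TM2.step program (config (some .scan) s [] T F B O) =
      some (config (some (if s.mode then .discard else .rewind)) s [] T F B O) := by
  simp [config, program, update_input, contents]

theorem step_scan_tally :
    Turing.TM2.step program (config (some .scan) s (.tally :: I) T F B O) =
      some (config (some .scan) (s.addTallies 1) I (.tally :: T) F B O) := by
  simp [config, program, update_input, update_saved, contents]

theorem step_scan_endRow :
    Turing.TM2.step program (config (some .scan) s (.endRow :: I) T F B O) =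
      some (config (some .retreat) s I (.endRow :: T) F B O) := by
  simp [config, program, update_input, update_saved, contents]

theorem step_scan_endEntry :
    Turing.TM2.step program (config (some .scan) s (.endEntry :: I) T F B O) =
      some (config (some .scan) (s.afterCell (F.head?.getD .initial)) I (.endEntry :: T) F.tail
        (s.scanCell (F.head?.getD .initial) :: B) O) := by
  simp [config, program, update_input, update_saved, update_front, update_back, contents]

theorem step_retreat_nil :
    Turing.TM2.step program (config (some .retreat) s I T F [] O) =
      some (config (some .scan) (.fresh s.mode) I T F [] O) := by
  simp [config, program, update_back, contents]

theorem step_retreat_cons (c : Cell) :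
    Turing.TM2.step program (config (some .retreat) s I T F (c :: B) O) =
      some (config (some .retreat) (s.afterRetreat c) I T (s.retreatCell c :: F) B O) := by
  simp [config, program, update_front, update_back, contents]

theorem step_rewind_nil :
    Turing.TM2.step program (config (some .rewind) s I [] F B O) =
      some (config (some .scan) (.fresh true) I [] F B O) := by
  simp [config, program, update_saved, contents]

theorem step_rewind_cons (a : Letter) :
    Turing.TM2.step program (config (some .rewind) s I (a :: T) F B O) =
      some (config (some .rewind) s (a :: I) T F B O) := by
  simp [config, program, update_input, update_saved, contents]

theorem step_discard_nil :
    Turing.TM2.step program (config (some .discard) s I [] F B O) =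
      some (config (some .collect) s I [] F B O) := by
  simp [config, program, update_saved, contents]

theorem step_discard_cons (a : Letter) :
    Turing.TM2.step program (config (some .discard) s I (a :: T) F B O) =
      some (config (some .discard) s I T F B O) := by
  simp [config, program, update_saved, contents]

theorem step_collect_nil :
    Turing.TM2.step program (config (some .collect) s I T [] B O) =
      some (config (some .emit) s I T [] B O) := by
  simp [config, program, update_front, contents]

theorem step_collect_cons (c : Cell) :
    Turing.TM2.step program (config (some .collect) s I T (c :: F) B O) =
      some (config (some .collect) s I T F (c :: B) O) := by
  simp [config, program, update_front, update_back, contents]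

theorem step_emit_nil :
    Turing.TM2.step program (config (some .emit) s I T F [] O) =
      some (config none (.fresh false) I T F [] O) := by
  simp [config, program, update_back, contents]

theorem step_emit_cons (c : Cell) :
    Turing.TM2.step program (config (some .emit) s I T F (c :: B) O) =
      some (config (some .emit) s I T F B (c.chosen :: O)) := by
  simp [config, program, update_back, update_output, contents]

end Steps

/-! ### Runs of each loop, with exact step counts -/

section Loops

variable (s : Flags) (I T : List Letter) (F B : List Cell) (O : List Bool)

theorem reaches_rewind : ReachesIn (T.length + 1) (config (some .rewind) s I T F B O)
    (config (some .scan) (.fresh true) (T.reverse ++ I) [] F B O) := by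
  induction T generalizing I with
  | nil => exact .head (step_rewind_nil s I F B O) (.refl _)
  | cons a T ih => simpa using ReachesIn.head (step_rewind_cons s I T F B O a) (ih (a :: I))

theorem reaches_discard : ReachesIn (T.length + 1) (config (some .discard) s I T F B O)
    (config (some .collect) s I [] F B O) := by
  induction T with
  | nil => exact .head (step_discard_nil s I F B O) (.refl _)
  | cons a T ih => exact .head (step_discard_cons s I T F B O a) ih

theorem reaches_collect : ReachesIn (F.length + 1) (config (some .collect) s I T F B O)
    (config (some .emit) s I T [] (F.reverse ++ B) O) := by
  induction F generalizing B with
  | nil => exact .head (step_collect_nil s I T B O) (.refl _)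
  | cons c F ih => simpa using ReachesIn.head (step_collect_cons s I T F B O c) (ih (c :: B))

theorem reaches_emit : ReachesIn (B.length + 1) (config (some .emit) s I T F B O)
    (config none (.fresh false) I T F [] ((B.map Cell.chosen).reverse ++ O)) := by
  induction B generalizing O with
  | nil => exact .head (step_emit_nil s I T F O) (.refl _)
  | cons c B ih => simpa using ReachesIn.head (step_emit_cons s I T F B O c) (ih (c.chosen :: O))

theorem reaches_retreat : ReachesIn (B.length + 1) (config (some .retreat) s I T F B O)
    (config (some .scan) (.fresh s.mode) I T ((s.retreatCells B).reverse ++ F) [] O) := by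
  induction B generalizing s F with
  | nil => exact .head (step_retreat_nil s I T F O) (.refl _)
  | cons c B ih =>
    simpa [Flags.retreatCells, Flags.afterRetreat] using ReachesIn.head
      (step_retreat_cons s I T F B O c) (ih (s.afterRetreat c) (s.retreatCell c :: F))

/-- The flags record a count truncated at two, and truncated addition is associative; once the
comparisons are split, a finite Boolean check remains. -/
theorem addTallies_addTallies (m k : ℕ) :
    (s.addTallies m).addTallies k = s.addTallies (m + k) := by
  have h0 : (0 < m + k) ↔ 0 < m ∨ 0 < k := by omega
  have h2 : 2 ≤ m + k ↔ (0 < m ∧ 0 < k) ∨ 2 ≤ m ∨ 2 ≤ k := by omega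
  simp only [Flags.addTallies, Flags.mk.injEq, true_and, and_true, h0, h2, Bool.decide_or,
    Bool.decide_and]
  generalize decide (0 < m) = a, decide (0 < k) = b, decide (2 ≤ m) = a', decide (2 ≤ k) = b',
    s.tally = x, s.seen = y, s.more = z
  revert a b a' b' x y z
  decide

theorem reaches_tallies (m : ℕ) :
    ReachesIn m (config (some .scan) s (List.replicate m .tally ++ I) T F B O)
      (config (some .scan) (s.addTallies m) I (List.replicate m .tally ++ T) F B O) := by
  induction m generalizing s T with
  | zero => simpa [Flags.addTallies] using ReachesIn.refl _
  | succ m ih =>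
    have h := ReachesIn.head (step_scan_tally s (List.replicate m .tally ++ I) T F B O)
      (ih (s.addTallies 1) (.tally :: T))
    rw [addTallies_addTallies, Nat.add_comm 1 m] at h
    rw [List.replicate_succ, List.cons_append]
    have e : List.replicate m Letter.tally ++ .tally :: T =
        .tally :: (List.replicate m .tally ++ T) := by
      rw [← List.singleton_append, ← List.append_assoc, ← List.replicate_succ',
        List.replicate_succ, List.cons_append]
    rw [e] at h
    exact h

/-- The letters of the entries of a row. -/
def entryLetters (rs : List (ℕ × Cell)) : List Letter :=
  rs.flatMap fun r => List.replicate r.1 .tally ++ [.endEntry]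

/-- The stack `F` represents the list `cs` of cells: missing cells count as initial ones. -/
def Represents (F cs : List Cell) : Prop := F = cs ∨ F = [] ∧ ∀ c ∈ cs, c = .initial

theorem reaches_entries (rs : List (ℕ × Cell)) (hF : Represents F (rs.map Prod.snd)) :
    ReachesIn (entryLetters rs).length
      (config (some .scan) s (entryLetters rs ++ I) T F B O)
      (config (some .scan) (s.scanFlags rs) I ((entryLetters rs).reverse ++ T) []
        ((s.scanCells rs).reverse ++ B) O) := by
  induction rs generalizing s T F B with
  | nil =>
    have : F = [] := by rcases hF with h | h <;> simp_all
    subst this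
    exact .refl _
  | cons r rs ih =>
    obtain ⟨m, c⟩ := r
    have hhead : F.head?.getD .initial = c := by
      rcases hF with rfl | ⟨rfl, h⟩
      · rfl
      · exact (h c (by simp)).symm
    have htail : Represents F.tail (rs.map Prod.snd) := by
      rcases hF with rfl | ⟨rfl, h⟩
      · exact Or.inl rfl
      · exact Or.inr ⟨rfl, fun c hc => h c (List.mem_cons_of_mem _ hc)⟩
    have h1 := reaches_tallies s (.endEntry :: (entryLetters rs ++ I)) T F B O m
    have h2 := step_scan_endEntry (s.addTallies m) (entryLetters rs ++ I)
      (List.replicate m .tally ++ T) F B O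
    rw [hhead] at h2
    have h3 := ih ((s.addTallies m).afterCell c) (.endEntry :: (List.replicate m .tally ++ T))
      F.tail ((s.addTallies m).scanCell c :: B) htail
    have h4 := h1.trans (.head h2 h3)
    have e1 : entryLetters ((m, c) :: rs) =
        List.replicate m .tally ++ .endEntry :: entryLetters rs := by
      simp [entryLetters]
    rw [e1]
    convert h4 using 1
    · simp
    · simp
    · simp [Flags.scanFlags, Flags.scanCells]

theorem reaches_row (rs : List (ℕ × Cell)) (hF : Represents F (rs.map Prod.snd)) :
    ReachesIn ((entryLetters rs ++ [Letter.endRow]).length + (rs.length + 1))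
      (config (some .scan) s (entryLetters rs ++ [.endRow] ++ I) T F [] O)
      (config (some .scan) (.fresh (s.scanFlags rs).mode) I
        ((entryLetters rs ++ [Letter.endRow]).reverse ++ T)
        ((s.scanFlags rs).retreatCells (s.scanCells rs).reverse).reverse [] O) := by
  have hlen : ∀ (s : Flags), (s.scanCells rs).length = rs.length := by
    induction rs generalizing F with
    | nil => exact fun _ => rfl
    | cons r rs ih =>
      intro s
      rw [Flags.scanCells, List.length_cons, List.length_cons,
        ih (rs.map Prod.snd) (Or.inl rfl)]
  have h1 := reaches_entries s (.endRow :: I) T F [] O rs hF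
  have h2 := step_scan_endRow (s.scanFlags rs) I ((entryLetters rs).reverse ++ T) []
    ((s.scanCells rs).reverse ++ []) O
  have h3 := reaches_retreat (s.scanFlags rs) I (.endRow :: ((entryLetters rs).reverse ++ T)) []
    ((s.scanCells rs).reverse ++ []) O
  convert h1.trans (.head h2 h3) using 1
  · simp [hlen]; omega
  · simp
  · simp

end Loops

/-! ### Reading one row performs one visit -/

section Row

variable {G : Multigraph}

/-- The cell of `v` when the set chosen so far is `C` and the rows before the `k`-th one have been
read in the present round. -/
def vertexCell (C : Finset (Fin G.numVerts)) (k : ℕ) (mode : Bool) (v : Fin G.numVerts) : Cell :=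
  ⟨decide (v ∈ C), decide (v.1 < k) != mode, false⟩

/-- The entry of the row of `u` in the column of `v`, and the cell of `v`. -/
def rowEntry (C : Finset (Fin G.numVerts)) (mode : Bool) (u v : Fin G.numVerts) : ℕ × Cell :=
  (G.mult s(u, v), vertexCell C u mode v)

variable (C : Finset (Fin G.numVerts)) (u : Fin G.numVerts)

/-- The vertex `v` is an uncovered neighbour of `u`. -/
def isUncovered (v : Fin G.numVerts) : Bool :=
  decide (0 < G.mult s(u, v)) && !decide (v ∈ C)

/-- The machine finds the diagonal without indices: the cells before `u` were passed in earlier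
rows, so `u` is the first one not passed. For the induction `vs` is the list of remaining columns,
and the two hypotheses on `diag` say on which side of the diagonal it begins. -/
theorem scan_row (vs : List (Fin G.numVerts)) (hvs : vs.Pairwise (· < ·)) (s : Flags)
    (htally : s.tally = false) (hdiag : s.diag = false → u ∈ vs)
    (hdiag' : s.diag = true → ∀ v ∈ vs, u < v) :
    s.scanCells (vs.map (rowEntry C s.mode u)) = vs.map (fun v => ⟨decide (v ∈ C),
        decide (v ≤ u) != s.mode, !s.found && (vs.find? (isUncovered C u) == some v)⟩) ∧
      s.scanFlags (vs.map (rowEntry C s.mode u)) =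
        { s.addTallies (vs.map fun v => G.mult s(u, v)).sum with
          tally := false
          found := s.found || (vs.find? (isUncovered C u)).isSome
          diag := true
          cur := if s.diag then s.cur else decide (u ∈ C) } := by
  induction vs generalizing s with
  | nil =>
    have hd : s.diag = true := by simpa using hdiag
    obtain ⟨mode, tally, seen, more, found, diag, cur⟩ := s
    simp_all [Flags.scanCells, Flags.scanFlags, Flags.addTallies]
  | cons v vs ih =>
    obtain ⟨hv, hvs'⟩ := List.pairwise_cons.1 hvs
    set t := (s.addTallies (G.mult s(u, v))).afterCell (vertexCell C u s.mode v) with ht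
    have hcur : (s.addTallies (G.mult s(u, v))).isCurrent (vertexCell C u s.mode v) =
        (!s.diag && decide (v = u)) := by
      have hpass : ((decide (v.1 < u.1) != s.mode) == s.mode) = !decide (v < u) := by
        change ((decide (v < u) != s.mode) == s.mode) = !decide (v < u)
        cases decide (v < u) <;> cases s.mode <;> rfl
      simp only [Flags.isCurrent, vertexCell, Flags.addTallies, hpass]
      cases hd : s.diag with
      | true => rfl
      | false =>
        have : u = v ∨ v < u := by
          rcases List.mem_cons.1 (hdiag hd) with h | h
          · exact Or.inl h
          · exact Or.inr (hv u h)
        rcases this with rfl | h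
        · simp
        · simp [h, h.ne]
    have hcand : (s.addTallies (G.mult s(u, v))).isCandidate (vertexCell C u s.mode v) =
        (isUncovered C u v && !s.found) := by
      simp [Flags.isCandidate, isUncovered, vertexCell, Flags.addTallies, htally]
    have htmode : t.mode = s.mode := rfl
    have htfound : t.found = (s.found || (isUncovered C u v && !s.found)) := by
      rw [ht, Flags.afterCell, hcand]
      rfl
    have htdiag : t.diag = (s.diag || (!s.diag && decide (v = u))) := by
      rw [ht, Flags.afterCell, hcur]
      rfl
    have htcur : t.cur = if (!s.diag && decide (v = u)) then decide (v ∈ C) else s.cur := by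
      rw [ht, Flags.afterCell, hcur]
      rfl
    have ih' := ih hvs' t rfl
      (by
        intro h
        rw [htdiag] at h
        have hd : s.diag = false := by
          cases hd : s.diag <;> simp_all
        have hvu : v ≠ u := by
          rintro rfl
          simp [hd] at h
        exact (List.mem_cons.1 (hdiag hd)).resolve_left hvu.symm)
      (by
        intro h w hw
        rw [htdiag] at h
        cases hd : s.diag with
        | true => exact hdiag' hd w (List.mem_cons_of_mem _ hw)
        | false =>
          have hvu : v = u := by simpa [hd] using h
          exact hvu ▸ hv w hw)
    rw [htmode] at ih'
    obtain ⟨ih1, ih2⟩ := ih'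
    have hnotMem : v ∉ vs := fun h => lt_irrefl v (hv v h)
    constructor
    · rw [List.map_cons, Flags.scanCells, List.map_cons]
      change _ :: t.scanCells (vs.map (rowEntry C s.mode u)) = _
      rw [ih1]
      congr 1
      · have hpass : (if (!s.diag && decide (v = u)) then !s.mode else decide (v.1 < u.1) != s.mode)
            = (decide (v ≤ u) != s.mode) := by
          cases hd : s.diag with
          | true =>
            have h1 := hdiag' hd v (by simp)
            simp [h1.not_ge, h1.not_gt]
          | false =>
            by_cases hvu : v = u
            · simp [hvu]
            · have : v < u ↔ v ≤ u := lt_iff_le_and_ne.trans (and_iff_left hvu)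
              simp [hvu, this]
        simp only [rowEntry, Flags.scanCell, hcur, hcand, Cell.mk.injEq]
        refine ⟨rfl, hpass, ?_⟩
        rw [List.find?_cons]
        cases hp : isUncovered C u v with
        | true => simp
        | false =>
          have : vs.find? (isUncovered C u) ≠ some v := fun h =>
            hnotMem (List.mem_of_find?_eq_some h)
          simp [this]
      · refine List.map_congr_left fun w hw => ?_
        rw [htfound, List.find?_cons]
        cases hp : isUncovered C u v with
        | true =>
          have : v ≠ w := fun h => hnotMem (h ▸ hw)
          simp [this]
        | false => simp
    · rw [List.map_cons, Flags.scanFlags]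
      change t.scanFlags (vs.map (rowEntry C s.mode u)) = _
      rw [ih2]
      -- Ending an entry clears `tally` but leaves `seen` and `more`, which accumulate over the
      -- whole row.
      have hsum : ∀ k, (t.addTallies k).seen =
            ((s.addTallies (G.mult s(u, v))).addTallies k).seen ∧
          (t.addTallies k).more = ((s.addTallies (G.mult s(u, v))).addTallies k).more := by
        intro k
        exact ⟨rfl, rfl⟩
      obtain ⟨h1, h2⟩ := hsum (vs.map fun v => G.mult s(u, v)).sum
      rw [addTallies_addTallies] at h1 h2
      rw [List.map_cons, List.sum_cons]
      simp only [Flags.mk.injEq]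
      refine ⟨rfl, trivial, h1, h2, ?_, trivial, ?_⟩
      · rw [htfound, List.find?_cons]
        cases isUncovered C u v <;> cases s.found <;> simp
      · rw [htdiag, htcur]
        by_cases hvu : v = u
        · subst hvu
          cases s.diag <;> simp
        · cases s.diag <;> simp [hvu]

/-- The cells now come in decreasing order and `u` has just been passed, so `u` is the first passed
one met. Here `diag` means that `u` is still to come. -/
theorem retreat_row (cand : Fin G.numVerts → Bool) (vs : List (Fin G.numVerts))
    (hvs : vs.Pairwise (· > ·)) (s : Flags) (hdiag : s.diag = true → u ∈ vs) :
    s.retreatCells (vs.map fun v => ⟨decide (v ∈ C), decide (v ≤ u) != s.mode, cand v⟩) =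
      vs.map fun v => ⟨decide (v ∈ C) || (s.ok && (cand v || (s.mode && s.diag && decide (v = u)))),
        decide (v ≤ u) != s.mode, false⟩ := by
  induction vs generalizing s with
  | nil => rfl
  | cons v vs ih =>
    obtain ⟨hv, hvs'⟩ := List.pairwise_cons.1 hvs
    have hpass : (s.diag && ((decide (v ≤ u) != s.mode) != s.mode)) =
        (s.diag && decide (v = u)) := by
      cases hd : s.diag with
      | false => rfl
      | true =>
        have h : u = v ∨ u < v := (List.mem_cons.1 (hdiag hd)).imp_right fun h => hv u h
        rcases h with rfl | h
        · cases s.mode <;> simp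
        · cases s.mode <;> simp [h.not_ge, h.ne']
    have hpass' : (s.diag && ((decide (v ≤ u) != s.mode) == s.mode)) =
        (s.diag && !decide (v = u)) := by
      revert hpass
      cases s.diag <;> cases decide (v ≤ u) <;> cases s.mode <;> cases decide (v = u) <;> decide
    rw [List.map_cons, List.map_cons, Flags.retreatCells]
    congr 1
    · simp only [Flags.retreatCell, Bool.and_assoc, hpass]
    · refine (ih hvs' (s.afterRetreat _) ?_).trans ?_
      · intro h
        have h' : (s.diag && !decide (v = u)) = true := hpass' ▸ h
        simp only [Bool.and_eq_true, Bool.not_eq_true', decide_eq_false_iff_not] at h'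
        exact (List.mem_cons.1 (hdiag h'.1)).resolve_left fun h => h'.2 h.symm
      · refine List.map_congr_left fun w hw => ?_
        have hdw : ((s.diag && !decide (v = u)) && decide (w = u)) =
            (s.diag && decide (w = u)) := by
          by_cases hwu : w = u
          · have : v ≠ u := by
              rintro rfl
              exact lt_irrefl v (hwu ▸ hv w hw)
            simp [this]
          · simp [hwu]
        simp only [Flags.afterRetreat, Flags.ok, Bool.and_assoc, hpass'] at hdw ⊢
        rw [hdw]

theorem visit_cells (mode : Bool) :
    (((Flags.fresh mode).scanFlags
        ((List.finRange G.numVerts).map (rowEntry C mode u))).retreatCells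
      ((Flags.fresh mode).scanCells
        ((List.finRange G.numVerts).map (rowEntry C mode u))).reverse).reverse =
      (List.finRange G.numVerts).map (vertexCell (G.visit mode C u) (u + 1) mode) := by
  obtain ⟨h1, h2⟩ := scan_row C u (List.finRange G.numVerts) (List.pairwise_lt_finRange _)
    (Flags.fresh mode) rfl (fun _ => List.mem_finRange u) (fun h => by simp [Flags.fresh] at h)
  change (Flags.fresh mode).scanCells ((List.finRange G.numVerts).map (rowEntry C mode u)) = _ at h1
  change (Flags.fresh mode).scanFlags ((List.finRange G.numVerts).map (rowEntry C mode u)) = _ at h2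
  set t := (Flags.fresh mode).scanFlags ((List.finRange G.numVerts).map (rowEntry C mode u))
  have htmode : t.mode = mode := by rw [h2]; rfl
  have htdiag : t.diag = true := by rw [h2]
  have hok : t.ok = true ↔ (G.firstUncovered C u).isSome ∧ u ∉ C ∧
      (mode = true ∨ G.incidence u = 1) := by
    have hsum : ((List.finRange G.numVerts).map fun v => G.mult s(u, v)).sum = G.incidence u := by
      rw [Multigraph.incidence, ← List.ofFn_eq_map, List.sum_ofFn]
    rw [h2, hsum]
    -- `seen` without `more` is the test that recognises a vertex with a single incident edge.
    have h1 : (decide (0 < G.incidence u) && !decide (2 ≤ G.incidence u)) = true ↔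
        G.incidence u = 1 := by
      simp
      omega
    simp only [Flags.ok, Flags.addTallies, Flags.fresh, Bool.false_or, Bool.and_eq_true,
      Bool.or_eq_true, Bool.false_and, Bool.false_eq_true, if_false, ← h1, Bool.not_eq_true',
      decide_eq_false_iff_not, and_assoc]
    rfl
  rw [h1, ← List.map_reverse]
  have h3 := retreat_row C u
    (fun v => !(Flags.fresh mode).found &&
      ((List.finRange G.numVerts).find? (isUncovered C u) == some v))
    (List.finRange G.numVerts).reverse
    (List.pairwise_reverse.2 (List.pairwise_lt_finRange _)) t (fun _ => by simp)
  rw [htmode] at h3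
  change List.reverse (t.retreatCells (List.map (fun v => ⟨decide (v ∈ C), decide (v ≤ u) != mode,
    !(Flags.fresh mode).found &&
      ((List.finRange G.numVerts).find? (isUncovered C u) == some v)⟩) _)) = _
  rw [h3, ← List.map_reverse, List.reverse_reverse]
  refine List.map_congr_left fun v _ => ?_
  simp only [vertexCell, Cell.mk.injEq, and_true]
  refine ⟨?_, by simp only [Fin.le_def, Nat.lt_succ_iff]⟩
  rw [Bool.eq_iff_iff, Bool.or_eq_true, Bool.and_eq_true, hok, htdiag]
  simp only [Bool.and_true, decide_eq_true_eq, Flags.fresh, Bool.not_false, Bool.true_and,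
    Bool.or_eq_true, beq_iff_eq, Bool.and_eq_true]
  change v ∈ C ∨ _ ∧ (G.firstUncovered C u = some v ∨ _) ↔ _
  unfold Multigraph.visit
  by_cases h : u ∉ C ∧ (mode = true ∨ G.incidence u = 1)
  · rw [if_pos h]
    cases hf : G.firstUncovered C u with
    | none => simp
    | some w =>
      cases mode <;> simp [h.1] <;> simp_all <;> tauto
  · rw [if_neg h]
    tauto

end Row

/-! ### Whole rounds and the total running time -/

section Pass

variable {G : Multigraph}

/-- The letters of the row of `u`. -/
def rowLetters (u : Fin G.numVerts) : List Letter :=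
  ((List.finRange G.numVerts).flatMap fun v =>
    List.replicate (G.mult s(u, v)) Letter.tally ++ [Letter.endEntry]) ++ [Letter.endRow]

/-- The list of the cells of all vertices. -/
def cellList (C : Finset (Fin G.numVerts)) (k : ℕ) (mode : Bool) : List Cell :=
  (List.finRange G.numVerts).map (vertexCell C k mode)

theorem mode_scanFlags (s : Flags) (rs : List (ℕ × Cell)) : (s.scanFlags rs).mode = s.mode := by
  induction rs generalizing s with
  | nil => rfl
  | cons r rs ih => exact ih _

theorem reaches_visit (mode : Bool) (C : Finset (Fin G.numVerts)) (u : Fin G.numVerts)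
    (I T : List Letter) (F : List Cell) (O : List Bool)
    (hF : Represents F (cellList C u mode)) :
    ReachesIn ((rowLetters u).length + (G.numVerts + 1))
      (config (some .scan) (.fresh mode) (rowLetters u ++ I) T F [] O)
      (config (some .scan) (.fresh mode) I ((rowLetters u).reverse ++ T)
        (cellList (G.visit mode C u) (u + 1) mode) [] O) := by
  have h := reaches_row (.fresh mode) I T F O
    ((List.finRange G.numVerts).map (rowEntry C mode u)) (by
      rw [List.map_map]
      exact hF)
  rw [visit_cells, mode_scanFlags] at h
  have e : entryLetters ((List.finRange G.numVerts).map (rowEntry C mode u)) ++ [.endRow] =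
      rowLetters u := by
    rw [entryLetters, List.flatMap_map]
    rfl
  rw [e, List.length_map, List.length_finRange] at h
  exact h

/-- One row suffices to turn an implicit list of initial cells into an actual one; `hF'` is needed
only when there is no row to do so. -/
theorem reaches_pass (mode : Bool) (us : List (Fin G.numVerts)) (k : ℕ)
    (hus : us.map Fin.val = List.range' k us.length) (C : Finset (Fin G.numVerts))
    (I T : List Letter) (F : List Cell) (O : List Bool)
    (hF : Represents F (cellList C k mode)) (hF' : us = [] → F = cellList C k mode) :
    ReachesIn ((us.flatMap rowLetters).length + us.length * (G.numVerts + 1))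
      (config (some .scan) (.fresh mode) (us.flatMap rowLetters ++ I) T F [] O)
      (config (some .scan) (.fresh mode) I ((us.flatMap rowLetters).reverse ++ T)
        (cellList (us.foldl (G.visit mode) C) (k + us.length) mode) [] O) := by
  induction us generalizing k C T F with
  | nil =>
    rw [hF' rfl]
    simpa using ReachesIn.refl _
  | cons u us ih =>
    rw [List.map_cons, List.length_cons, List.range'_succ, List.cons.injEq] at hus
    obtain ⟨rfl, hus⟩ := hus
    have h1 := reaches_visit mode C u (us.flatMap rowLetters ++ I) T F O hF
    have h2 := ih (u.1 + 1) hus (G.visit mode C u) ((rowLetters u).reverse ++ T) _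
      (Or.inl rfl) (fun _ => rfl)
    convert h1.trans h2 using 1
    · simp only [List.flatMap_cons, List.length_append, List.length_cons]
      ring
    · simp
    · simp [Nat.add_assoc, Nat.add_comm 1]

theorem reaches_round (mode : Bool) (C : Finset (Fin G.numVerts)) (T : List Letter)
    (F : List Cell) (O : List Bool) (hF : Represents F (cellList C 0 mode)) :
    ReachesIn (G.encode.length + G.numVerts * (G.numVerts + 1))
      (config (some .scan) (.fresh mode) G.encode T F [] O)
      (config (some .scan) (.fresh mode) [] (G.encode.reverse ++ T)
        (cellList ((List.finRange G.numVerts).foldl (G.visit mode) C) G.numVerts mode) [] O) := by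
  have h := reaches_pass mode (List.finRange G.numVerts) 0
    (by simp [List.map_coe_finRange_eq_range, List.range_eq_range']) C [] T F O hF (by
      intro h0
      rcases hF with hF | ⟨hF, -⟩
      · exact hF
      · rw [hF, cellList, h0, List.map_nil])
  rw [List.append_nil, List.length_finRange, Nat.zero_add] at h
  exact h

/-- The meaning of `passed` is reversed between the rounds, so "all passed" in one round reads as
"none passed" in the next and no reset is needed. -/
theorem cellList_numVerts (C : Finset (Fin G.numVerts)) (mode : Bool) :
    cellList C G.numVerts mode = cellList C 0 (!mode) := by
  refine List.map_congr_left fun v _ => ?_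
  simp [vertexCell]

/-- The input is read twice, restored once and discarded once; each of the `n` rows in each round
needs a retreat of `n + 1` steps; the output takes `2n` steps, and six more steps detect empty
stacks. -/
theorem reaches_halt (G : Multigraph) :
    ReachesIn (4 * G.encode.length + 2 * (G.numVerts * (G.numVerts + 1)) + 2 * G.numVerts + 6)
      (config (some .scan) (.fresh false) G.encode [] [] [] [])
      (config none (.fresh false) [] [] [] []
        (encodeVertexSet ⟨G.numVerts, G.greedyCover⟩)) := by
  have h1 := reaches_round (G := G) false ∅ [] [] [] (Or.inr ⟨rfl, by
    simp [cellList, vertexCell, Cell.initial]⟩)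
  rw [cellList_numVerts] at h1
  have h2 := step_scan_nil (.fresh false) (G.encode.reverse ++ [])
    (cellList G.leafCover 0 true) [] []
  have h3 := reaches_rewind (.fresh false) [] (G.encode.reverse ++ [])
    (cellList G.leafCover 0 true) [] []
  rw [List.append_nil, List.reverse_reverse, List.append_nil] at h3
  have h4 := reaches_round (G := G) true G.leafCover []
    (cellList G.leafCover 0 true) [] (Or.inl rfl)
  have h5 := step_scan_nil (.fresh true) (G.encode.reverse ++ [])
    (cellList G.greedyCover G.numVerts true) [] []
  have h6 := reaches_discard (.fresh true) [] (G.encode.reverse ++ [])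
    (cellList G.greedyCover G.numVerts true) [] []
  have h7 := reaches_collect (.fresh true) [] [] (cellList G.greedyCover G.numVerts true) [] []
  have h8 := reaches_emit (.fresh true) [] [] []
    ((cellList G.greedyCover G.numVerts true).reverse ++ []) []
  have hout : ((((cellList G.greedyCover G.numVerts true).reverse ++ []).map
      Cell.chosen).reverse ++ [] : List Bool) = encodeVertexSet ⟨G.numVerts, G.greedyCover⟩ := by
    rw [List.append_nil, List.append_nil, List.map_reverse, List.reverse_reverse, cellList,
      List.map_map, encodeVertexSet, List.ofFn_eq_map]
    rfl
  rw [hout] at h8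
  rw [List.append_nil] at h1 h2 h4 h5 h6
  have h := h1.trans (.head h2 (h3.trans (h4.trans (.head h5 (h6.trans (h7.trans h8))))))
  convert h using 1
  simp only [cellList, List.length_append, List.length_reverse, List.length_map,
    List.length_finRange, List.length_nil]
  ring

theorem length_mul_le_length_flatMap {A B : Type*} (l : List A) (f : A → List B) (k : ℕ)
    (h : ∀ a, k ≤ (f a).length) : l.length * k ≤ (l.flatMap f).length := by
  induction l with
  | nil => simp
  | cons a l ih =>
    rw [List.flatMap_cons, List.length_append, List.length_cons, Nat.succ_mul]
    have := h a
    omega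

theorem numVerts_mul_le_length_encode (G : Multigraph) :
    G.numVerts * (G.numVerts + 1) ≤ G.encode.length := by
  have h := length_mul_le_length_flatMap (List.finRange G.numVerts) (rowLetters (G := G))
    (G.numVerts + 1) fun u => by
      have h := length_mul_le_length_flatMap (List.finRange G.numVerts)
        (fun v => List.replicate (G.mult s(u, v)) Letter.tally ++ [Letter.endEntry]) 1
        fun v => by simp
      rw [List.length_finRange, mul_one] at h
      rw [rowLetters, List.length_append, List.length_singleton]
      omega
  rw [List.length_finRange] at h
  exact h

theorem initList_machine (I : List Letter) :
    Turing.initList machine I = config (some .scan) (.fresh false) I [] [] [] [] := by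
  refine congrArg (Turing.TM2.Cfg.mk (some Label.scan) (⟨none, none, .fresh false⟩ : State)) ?_
  funext k
  cases k <;> rfl

theorem haltList_machine (O : List Bool) :
    Turing.haltList machine O = config none (.fresh false) [] [] [] [] O := by
  refine congrArg (Turing.TM2.Cfg.mk none (⟨none, none, .fresh false⟩ : State)) ?_
  funext k
  cases k <;> rfl

end Pass

/-- The machine computes the vertex cover in linear time. -/
noncomputable def computableInPolyTime :
    Turing.TM2ComputableInPolyTime Multigraph.encode encodeVertexSet
      (fun G => (⟨G.numVerts, G.greedyCover⟩ : (n : ℕ) × Finset (Fin n))) where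
  tm := machine
  inputAlphabet := Equiv.refl Letter
  outputAlphabet := Equiv.refl Bool
  time := 8 * Polynomial.X + 6
  outputsFun G :=
    { steps := 4 * G.encode.length + 2 * (G.numVerts * (G.numVerts + 1)) + 2 * G.numVerts + 6
      evals_in_steps := by
        have hI : G.encode.map (Equiv.refl Letter).invFun = G.encode := List.map_id _
        have hO : (encodeVertexSet ⟨G.numVerts, G.greedyCover⟩).map (Equiv.refl Bool).invFun =
          encodeVertexSet ⟨G.numVerts, G.greedyCover⟩ := List.map_id _
        have hinit := (congrArg (Turing.initList machine) hI).trans (initList_machine _)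
        have hhalt := (congrArg (Turing.haltList machine) hO).trans (haltList_machine _)
        exact (congrArg (fun c => (flip bind machine.step)^[_] (some c)) hinit).trans
          (Eq.trans (reaches_halt G) (congrArg some hhalt.symm))
      steps_le_m := by
        -- Both `2n(n + 1)` and `2n` are at most twice the input length, whence the coefficient `8 =
        -- 4 + 2 + 2`.
        have h := numVerts_mul_le_length_encode G
        simp only [Polynomial.eval_add, Polynomial.eval_mul, Polynomial.eval_X,
          Polynomial.eval_ofNat]
        nlinarith }

end CoverMachine

theorem isPolyTimeVertexCoverAlgorithm_greedyCover :
    IsPolyTimeVertexCoverAlgorithm Multigraph.greedyCover :=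
  ⟨Multigraph.isVertexCover_greedyCover, ⟨CoverMachine.computableInPolyTime⟩⟩

end PowerLaw

theorem theorem1 :
    ∃ A : (G : PowerLaw.Multigraph) → Finset (Fin G.numVerts),
      PowerLaw.IsPolyTimeVertexCoverAlgorithm A ∧
      ∀ β : ℝ, 2 < β → ∀ α : ℝ, 0 ≤ α →
        ∀ (n : ℕ) (d : Fin n → ℕ), PowerLaw.IsPowerLawDegreeSequence α β d →
          PowerLaw.expectation d (fun G => ((A G).card : ℝ) / (G.vertexCoverNumber : ℝ)) ≤
            2 - ((riemannZeta (β : ℂ)).re - 1 - 1 / (2 : ℝ) ^ β) /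
              ((2 : ℝ) ^ β * (riemannZeta ((β : ℂ) - 1)).re * (riemannZeta (β : ℂ)).re) :=
  ⟨PowerLaw.Multigraph.greedyCover, PowerLaw.isPolyTimeVertexCoverAlgorithm_greedyCover,
    fun _ hβ _ hα _ _ hd => PowerLaw.expectation_greedyCover_le hα hβ hd⟩
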